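/- Let $\mathbf K$ be a monoidal triangulated category, i.e. a triangulated category with a monoidal structure $(\otimes,1)$ such that $\otimes$ is exact in each variable. An object $C$ is compact if $\mathbf K(C,-)$ commutes with set-indexed coproducts; $\mathbf K^c$ is the full subcategory of compact objects. Assume that $\mathbf K$ is compactly generated: it has all set-indexed coproducts and $\otimes$ preserves them in each variable, the isomorphism classes of compact objects form a set, every non-zero object receives a non-zero morphism from some compact object, $1$ is compact, tensor products of compact objects are compact, and every compact object is rigid (has a left and a right dual). A thick ideal is a full triangulated subcategory closed under direct summands and under tensoring on either side with arbitrary objects. For $M\in\mathbf K^c$ let $\langle M\rangle\subseteq\mathbf K^c$ be the thick ideal of $\mathbf K^c$ generated by $M$; for $M\in\mathbf K$ let $\langle\!\langle M\rangle\!\rangle$ be the thick ideal of $\mathbf K$ generated by $M$. Let $X$ be a Zariski space (a Noetherian topological space in which every irreducible closed subset has a unique generic point), and let $\sigma$ be an extended weak support datum, i.e. a map assigning to each object of $\mathbf K$ a subset of $X$ such that, with $\Phi_\sigma(\mathcal S)=\bigcup_{A\in\mathcal S}\sigma(A)$ for a class $\mathcal S$ of objects: (a) $\sigma(0)=\varnothing$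 and $\sigma(1)=X$; (b) $\sigma(\bigoplus_{i\in I}A_i)=\bigcup_{i\in I}\sigma(A_i)$ for all set-indexed families of objects; (c) $\sigma(\Sigma A)=\sigma(A)$ for all $A$; (d) $\sigma(A)\subseteq\sigma(B)\cup\sigma(C)$ for each distinguished triangle $A\to B\to C\to\Sigma A$; (e) $\Phi_\sigma(\mathbf I\otimes\mathbf J)=\Phi_\sigma(\mathbf I)\cap\Phi_\sigma(\mathbf J)$ for all thick ideals $\mathbf I,\mathbf J$ of $\mathbf K$, where $\mathbf I\otimes\mathbf J=\{A\otimes B: A\in\mathbf I,\ B\in\mathbf J\}$. Assume moreover that $\sigma$ is faithful: for every $M\in\mathbf K$, $\Phi_\sigma(\langle\!\langle M\rangle\!\rangle)=\varnothing$ if and only if $M=0$. Then for every $M\in\mathbf K^c$, $$\{N\in\mathbf K^c : \Phi_\sigma(\langle N\rangle)\subseteq\Phi_\sigma(\langle M\rangle)\}=\langle M\rangle .$$ -/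

import Mathlib

open CategoryTheory CategoryTheory.Limits CategoryTheory.Pretriangulated
open CategoryTheory.MonoidalCategory Opposite

universe v u w

namespace NCHopkins

section Topology

/-- A Zariski space: a Noetherian topological space in which every irreducible closed
subset has a unique generic point. -/
structure IsZariskiSpace (X : Type w) [TopologicalSpace X] : Prop where
  noetherian : TopologicalSpace.NoetherianSpace X
  existsUnique_generic : ∀ Z : Set X, IsIrreducible Z → IsClosed Z → ∃! x, closure {x} = Z

end Topology

section Triangulated

variable {K : Type u} [Category.{v} K] [Preadditive K]

/-- An object `C` is compact if `K(C, -)`, as a functor to abelian groups, commutes with all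
set-indexed coproducts. -/
def IsCompactObj : ObjectProperty K := fun C =>
  ∀ ι : Type v, PreservesColimitsOfShape (Discrete ι) (preadditiveCoyoneda.obj (op C))

variable [HasZeroObject K] [HasShift K ℤ] [∀ n : ℤ, (shiftFunctor K n).Additive]
  [Pretriangulated K]

/-- A functor between triangulated categories (here: an endofunctor) is exact if it commutes with
the shift in such a way that it maps distinguished triangles to distinguished triangles. (Such a
functor is automatically additive.) -/
def IsExactFunctor (F : K ⥤ K) : Prop :=
  ∃ _ : F.CommShift ℤ, F.IsTriangulated

variable [MonoidalCategory K]

variable (K) in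
/-- A triangulated category which is also monoidal is a monoidal triangulated category if the
tensor product is exact in each variable. -/
structure IsMonoidalTriangulated : Prop where
  octahedral : IsTriangulated K
  exact_tensorLeft : ∀ A : K, IsExactFunctor (tensorLeft A)
  exact_tensorRight : ∀ A : K, IsExactFunctor (tensorRight A)

variable (K) in
/-- A compactly generated monoidal triangulated category. -/
structure IsCompactlyGeneratedMonoidal : Prop extends IsMonoidalTriangulated K where
  hasCoproducts : HasCoproducts.{v} K
  tensorLeft_coproducts : ∀ (A : K) (ι : Type v),
    PreservesColimitsOfShape (Discrete ι) (tensorLeft A)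
  tensorRight_coproducts : ∀ (A : K) (ι : Type v),
    PreservesColimitsOfShape (Discrete ι) (tensorRight A)
  compact_essentiallySmall : ObjectProperty.EssentiallySmall.{v} (IsCompactObj (K := K))
  exists_nonzero_hom : ∀ M : K, ¬ IsZero M → ∃ (C : K) (f : C ⟶ M), IsCompactObj C ∧ f ≠ 0
  compact_tensor : ∀ A B : K, IsCompactObj A → IsCompactObj B → IsCompactObj (A ⊗ B)
  compact_unit : IsCompactObj (𝟙_ K)
  rigid : ∀ A : K, IsCompactObj A → Nonempty (HasLeftDual A) ∧ Nonempty (HasRightDual A)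

/-- Let `A` be a full monoidal triangulated subcategory of `K` (below: all of `K`, or the compact
objects). `IsThickIdealOf A I` says that `I` is a thick two-sided ideal of `A`: a non-empty full
subcategory of `A`, closed under all shifts, under two-out-of-three in the distinguished triangles
of `A`, under direct summands in `A`, and under tensoring on either side with objects of `A`. -/
structure IsThickIdealOf (A I : ObjectProperty K) : Prop where
  le : I ≤ A
  nonempty : ∃ M, I M
  shift : ∀ (M : K) (n : ℤ), I M → I (M⟦n⟧)
  ext₁ : ∀ T ∈ distTriang K, A T.obj₁ → I T.obj₂ → I T.obj₃ → I T.obj₁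
  ext₂ : ∀ T ∈ distTriang K, A T.obj₂ → I T.obj₁ → I T.obj₃ → I T.obj₂
  ext₃ : ∀ T ∈ distTriang K, A T.obj₃ → I T.obj₁ → I T.obj₂ → I T.obj₃
  summand : ∀ M N P : K, A M → A N → I P → Nonempty (P ≅ M ⊞ N) → I M ∧ I N
  tensor_left : ∀ M B : K, A B → I M → I (B ⊗ M)
  tensor_right : ∀ M B : K, A B → I M → I (M ⊗ B)

/-- The smallest thick two-sided ideal of `A` containing the object `M` of `A`. -/
def thickIdealOf (A : ObjectProperty K) (M : K) : ObjectProperty K := fun N =>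
  ∀ I : ObjectProperty K, IsThickIdealOf A I → I M → I N

/-- For `M` compact, `⟨M⟩`: the thick two-sided ideal of the category of compact objects of `K`
generated by `M`. -/
def compactIdeal (M : K) : ObjectProperty K := thickIdealOf IsCompactObj M

/-- `⟪M⟫`: the thick two-sided ideal of the whole category `K` generated by `M`. -/
def bigIdeal (M : K) : ObjectProperty K := thickIdealOf ⊤ M

/-- The class `I ⊗ J` of all objects isomorphic to some `A ⊗ B` with `A` in `I`, `B` in `J`. -/
def tensorClass (I J : ObjectProperty K) : ObjectProperty K := fun C =>
  ∃ A B : K, I A ∧ J B ∧ Nonempty (C ≅ A ⊗ B)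

/-- The map `Φ_σ(S) = ⋃_{A ∈ S} σ(A)` on classes of objects. -/
def Phi {X : Type w} (σ : K → Set X) (S : ObjectProperty K) : Set X :=
  {x | ∃ A : K, S A ∧ x ∈ σ A}

/-- Extended weak support data with values in the subsets of `X`, on a monoidal triangulated
category with set-indexed coproducts. -/
structure IsExtendedWeakSupport {X : Type w} (σ : K → Set X) : Prop where
  zero : ∀ Z : K, IsZero Z → σ Z = ∅
  unit : σ (𝟙_ K) = Set.univ
  coproduct : ∀ (ι : Type v) (A : ι → K) (c : Cofan A), Nonempty (IsColimit c) →
    σ c.pt = ⋃ i, σ (A i)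
  shift : ∀ A : K, σ (A⟦(1 : ℤ)⟧) = σ A
  triangle : ∀ T ∈ distTriang K, σ T.obj₁ ⊆ σ T.obj₂ ∪ σ T.obj₃
  tensor : ∀ I J : ObjectProperty K, IsThickIdealOf ⊤ I → IsThickIdealOf ⊤ J →
    Phi σ (tensorClass I J) = Phi σ I ∩ Phi σ J

/-- The faithfulness property: `Φ_σ(⟪M⟫) = ∅` if and only if `M = 0`. -/
def IsFaithful {X : Type w} (σ : K → Set X) : Prop :=
  ∀ M : K, Phi σ (bigIdeal M) = ∅ ↔ IsZero M

/-- The class `I_Y` of all compact `N` with `Φ_σ(⟨N⟩) ⊆ Y`. -/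
def supportedIn {X : Type w} (σ : K → Set X) (Y : Set X) : ObjectProperty K := fun N =>
  IsCompactObj N ∧ Phi σ (compactIdeal N) ⊆ Y

end Triangulated

end NCHopkins

/-!
Let `I = ⟨M⟩`, and let `N` be compact with `Φ_σ(⟨N⟩) ⊆ Φ_σ(⟨M⟩)`. The point is to show that `N` lies
in the localizing subcategory of `K` generated by `I`; a compact object there already lies in `I`.

Bousfield localization away from `I` (`exists_bousfield_triangle`) gives a triangle `E ⟶ 1 ⟶ L` with
`E` in the localizing subcategory generated by `I`, and `L` in the right orthogonal `I^⊥`. Rigidity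
and the fact that the compact objects generate `K` (`of_isLocalizingClass`) make `I^⊥` a thick ideal
of `K` (`isThickIdealOf_rightOrthogonal`), which is annihilated by `M`
(`isZero_tensor_rightOrthogonal`). So `N ⊗ L` is in `I^⊥`, and `⟪M⟫ ⊗ ⟪N ⊗ L⟫ = 0`. On the other
hand `Φ_σ(⟪N⟫) ⊆ Φ_σ(⟨N⟩)` (`Phi_bigIdeal_subset`), again because the compact objects generate, and
therefore `Φ_σ(⟪N ⊗ L⟫) ⊆ Φ_σ(⟪N⟫) ⊆ Φ_σ(⟪M⟫)`. The tensor product property of `σ` turns this into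
`Φ_σ(⟪N ⊗ L⟫) = Φ_σ(⟪M⟫ ⊗ ⟪N ⊗ L⟫) = ∅`, and faithfulness gives `N ⊗ L = 0`, that is
`N ≅ N ⊗ E`.

For the descent to `I`, the object `E'` of the localization triangle `E' ⟶ N ⟶ L'` of `N` is a
mapping telescope of finite extensions of coproducts of objects of `I`. As `N ⟶ L'` is zero and `N`
is compact, `N` is a retract of one such finite extension. Every morphism from a compact object to
it is killed by a morphism with cone in `I` (`exists_trW_comp_eq_zero`), which makes `N` a
retract of an object of `I`.
-/

/-! ### Compact objects and finite sums -/

namespace NCHopkins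

section Compact

variable {K : Type u} [Category.{v} K] [Preadditive K]

/-- A morphism from a compact object to a coproduct is a finite sum of morphisms to the summands. -/
lemma IsCompactObj.exists_eq_sum {C : K} (hC : IsCompactObj C) {ι : Type v} {A : ι → K}
    {c : Cofan A} (hc : IsColimit c) (h : C ⟶ c.pt) :
    ∃ (s : Finset ι) (g : ∀ i, C ⟶ A i), h = ∑ i ∈ s, g i ≫ c.inj i := by
  classical
  have := hC ι
  let φ : ∀ i, (C ⟶ A i) →+ (C ⟶ c.pt) := fun i =>
    { toFun := fun g => g ≫ c.inj i
      map_zero' := zero_comp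
      map_add' := fun a b => Preadditive.add_comp _ _ _ _ _ _ }
  let S : AddSubgroup (C ⟶ c.pt) := (DFinsupp.liftAddHom φ).range
  let q : (preadditiveCoyoneda.obj (op C)).obj c.pt ⟶ AddCommGrpCat.of ((C ⟶ c.pt) ⧸ S) :=
    AddCommGrpCat.ofHom (QuotientAddGroup.mk' S)
  have hq : q = 0 := by
    refine (isColimitOfPreserves (preadditiveCoyoneda.obj (op C)) hc).hom_ext fun ⟨i⟩ => ?_
    ext g
    refine (QuotientAddGroup.eq_zero_iff (N := S) _).2 ⟨DFinsupp.single i g, ?_⟩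
    exact DFinsupp.sumAddHom_single φ i g
  have hS : h ∈ S := by
    have := congrArg (fun f => f.hom h) hq
    exact (QuotientAddGroup.eq_zero_iff (N := S) _).1 this
  obtain ⟨g, rfl⟩ := hS
  refine ⟨g.support, g, ?_⟩
  simp [DFinsupp.sumAddHom_apply, DFinsupp.sum, φ]

/-- Projection of a coproduct to one of its summands, which exists thanks to zero morphisms. -/
noncomputable def cofanProj {ι : Type*} {A : ι → K} {c : Cofan A} (hc : IsColimit c) (j : ι) :
    c.pt ⟶ A j :=
  open Classical in
  Cofan.IsColimit.desc hc fun i => if h : i = j then eqToHom (by rw [h]) else 0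

lemma inj_cofanProj_self {ι : Type*} {A : ι → K} {c : Cofan A} (hc : IsColimit c) (j : ι) :
    c.inj j ≫ cofanProj hc j = 𝟙 _ := by
  simp [cofanProj]

lemma inj_cofanProj_of_ne {ι : Type*} {A : ι → K} {c : Cofan A} (hc : IsColimit c) {i j : ι}
    (h : i ≠ j) : c.inj i ≫ cofanProj hc j = 0 := by
  simp [cofanProj, h]

/-- The components of a finite sum of morphisms to the summands. -/
lemma sum_inj_cofanProj {C : K} {ι : Type*} [DecidableEq ι] {A : ι → K} {c : Cofan A}
    (hc : IsColimit c) (s : Finset ι) (g : ∀ i, C ⟶ A i) (j : ι) :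
    (∑ i ∈ s, g i ≫ c.inj i) ≫ cofanProj hc j = if j ∈ s then g j else 0 := by
  rw [Preadditive.sum_comp]
  split_ifs with hj
  · rw [Finset.sum_eq_single_of_mem j hj fun i _ hij => by
      rw [Category.assoc, inj_cofanProj_of_ne hc hij, comp_zero]]
    rw [Category.assoc, inj_cofanProj_self, Category.comp_id]
  · refine Finset.sum_eq_zero fun i hi => ?_
    have hij : i ≠ j := by rintro rfl; exact hj hi
    rw [Category.assoc, inj_cofanProj_of_ne hc hij, comp_zero]

/-- Conversely, an object is compact as soon as every morphism from it to a coproduct is a finite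
sum of morphisms to the summands: injectivity of the comparison map is automatic, because the
components of such a morphism can be read off with the projections. -/
lemma isCompactObj_of_exists_eq_sum {C : K}
    (H : ∀ (ι : Type v) (A : ι → K) (c : Cofan A), IsColimit c → ∀ h : C ⟶ c.pt,
      ∃ (s : Finset ι) (g : ∀ i, C ⟶ A i), h = ∑ i ∈ s, g i ≫ c.inj i) :
    IsCompactObj C := by
  classical
  intro ι
  suffices ∀ A : ι → K, PreservesColimit (Discrete.functor A) (preadditiveCoyoneda.obj (op C)) from
    preservesColimitsOfShape_of_discrete _
  refine fun A => ⟨fun {c} hc => ⟨?_⟩⟩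
  let c' : Cofan A := c
  have hc' : IsColimit c' := hc
  let F := preadditiveCoyoneda.obj (op C)
  have hfin (h : C ⟶ c'.pt) : {j | h ≫ cofanProj hc' j ≠ 0}.Finite := by
    obtain ⟨s, g, rfl⟩ := H ι A c' hc' h
    refine s.finite_toSet.subset fun j hj => ?_
    by_contra hjs
    exact hj (by rw [sum_inj_cofanProj, if_neg (by simpa using hjs)])
  let τ (t : Cocone (Discrete.functor A ⋙ F)) (i : ι) : (C ⟶ A i) →+ t.pt := (t.ι.app ⟨i⟩).hom
  let d (t : Cocone (Discrete.functor A ⋙ F)) : (C ⟶ c'.pt) →+ t.pt :=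
    { toFun := fun h => ∑ᶠ i, τ t i (h ≫ cofanProj hc' i)
      map_zero' := by
        simp only [zero_comp]
        exact finsum_eq_zero_of_forall_eq_zero fun i => map_zero (τ t i)
      map_add' := fun a b => by
        have hs (h : C ⟶ c'.pt) :
            (Function.support fun i => τ t i (h ≫ cofanProj hc' i)).Finite :=
          (hfin h).subset fun i hi h0 => hi (by
            simp only [h0, map_zero])
        rw [← finsum_add_distrib (hs a) (hs b)]
        refine finsum_congr fun i => ?_
        rw [Preadditive.add_comp, map_add] }
  have hd (t : Cocone (Discrete.functor A ⋙ F)) (i : ι) (g : C ⟶ A i) :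
      d t (g ≫ c'.inj i) = τ t i g := by
    change ∑ᶠ j, τ t j ((g ≫ c'.inj i) ≫ cofanProj hc' j) = _
    rw [finsum_eq_single _ i]
    · rw [Category.assoc, inj_cofanProj_self, Category.comp_id]
    · intro j hj
      rw [Category.assoc, inj_cofanProj_of_ne hc' hj.symm, comp_zero, map_zero]
  refine { desc := fun t => AddCommGrpCat.ofHom (d t), fac := ?_, uniq := ?_ }
  · rintro t ⟨i⟩
    ext g
    exact hd t i g
  · intro t m hm
    ext h
    obtain ⟨s, g, rfl⟩ := H ι A c' hc' h
    let m' : (C ⟶ c'.pt) →+ t.pt := m.hom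
    change m' _ = d t _
    rw [map_sum, map_sum]
    refine Finset.sum_congr rfl fun i _ => ?_
    rw [hd]
    exact congrArg (fun f => f.hom (g i)) (hm ⟨i⟩)

lemma IsCompactObj.of_iso {C D : K} (hC : IsCompactObj C) (e : C ≅ D) : IsCompactObj D :=
  isCompactObj_of_exists_eq_sum fun ι A c hc h => by
    obtain ⟨s, g, hg⟩ := hC.exists_eq_sum hc (e.hom ≫ h)
    exact ⟨s, fun i => e.inv ≫ g i, by
      simp only [Category.assoc, ← Preadditive.comp_sum, ← hg, Iso.inv_hom_id_assoc]⟩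

/-- The image of a coproduct under a functor that preserves coproducts, as a coproduct of the images
of the summands. -/
noncomputable def isColimitMapCofan (G : K ⥤ K) {ι : Type*}
    [PreservesColimitsOfShape (Discrete ι) G] {A : ι → K} {c : Cofan A} (hc : IsColimit c) :
    IsColimit (Cofan.mk (G.obj c.pt) fun i => G.map (c.inj i)) :=
  isColimitCofanMkObjOfIsColimit G A c.inj
    (hc.ofIsoColimit (Cofan.ext (Iso.refl _) (by simp)))

/-- A left adjoint preserves compact objects if its right adjoint preserves coproducts. -/
lemma IsCompactObj.map_leftAdjoint {F G : K ⥤ K} [F.Additive] (adj : F ⊣ G)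
    (hG : ∀ ι : Type v, PreservesColimitsOfShape (Discrete ι) G) {C : K} (hC : IsCompactObj C) :
    IsCompactObj (F.obj C) :=
  isCompactObj_of_exists_eq_sum fun ι A c hc h => by
    have := hG ι
    obtain ⟨s, g, hg⟩ := hC.exists_eq_sum (isColimitMapCofan G hc)
      (adj.homEquiv _ _ h)
    refine ⟨s, fun i => (adj.homEquiv _ _).symm (g i), ?_⟩
    rw [← Equiv.symm_apply_apply (adj.homEquiv _ _) h, hg, Adjunction.homEquiv_counit,
      F.map_sum, Preadditive.sum_comp]
    refine Finset.sum_congr rfl fun i _ => ?_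
    rw [← Adjunction.homEquiv_naturality_right_symm, Adjunction.homEquiv_counit]
    rfl

end Compact

section Triangulated

variable {K : Type u} [Category.{v} K] [Preadditive K] [HasShift K ℤ]
  [∀ n : ℤ, (shiftFunctor K n).Additive]

lemma IsCompactObj.shift {C : K} (hC : IsCompactObj C) (n : ℤ) : IsCompactObj (C⟦n⟧) :=
  hC.map_leftAdjoint (F := shiftFunctor K n) (G := shiftFunctor K (-n))
    (shiftEquiv K n).toAdjunction fun _ => inferInstance

variable [HasZeroObject K] [Pretriangulated K]

/-- In a distinguished triangle with first and second object compact, the third is compact. A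
morphism `h` from the third object to a coproduct becomes a finite sum on the second object, so that
after removal of finitely many components it factors through the suspension of the first one. -/
lemma IsCompactObj.ext₃ {T : Triangle K} (hT : T ∈ distTriang K) (h₁ : IsCompactObj T.obj₁)
    (h₂ : IsCompactObj T.obj₂) : IsCompactObj T.obj₃ := by
  classical
  refine isCompactObj_of_exists_eq_sum fun ι A c hc h => ?_
  obtain ⟨s, g, hg⟩ := h₂.exists_eq_sum hc (T.mor₂ ≫ h)
  let p : c.pt ⟶ c.pt := ∑ i ∈ s, cofanProj hc i ≫ c.inj i
  have hp : T.mor₂ ≫ (h - h ≫ p) = 0 := by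
    have : (T.mor₂ ≫ h) ≫ p = T.mor₂ ≫ h := by
      rw [hg, Preadditive.comp_sum]
      refine Finset.sum_congr rfl fun i hi => ?_
      rw [← Category.assoc, sum_inj_cofanProj, if_pos hi]
    rw [Preadditive.comp_sub, ← Category.assoc, this, sub_self]
  obtain ⟨k, hk⟩ := Triangle.yoneda_exact₃ _ hT _ hp
  obtain ⟨t, l, hl⟩ := (h₁.shift 1).exists_eq_sum hc k
  refine ⟨s ∪ t, fun i => (if i ∈ s then h ≫ cofanProj hc i else 0) +
    (if i ∈ t then T.mor₃ ≫ l i else 0), ?_⟩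
  have h1 : h = h ≫ p + T.mor₃ ≫ k := by
    rw [← sub_eq_iff_eq_add']; exact hk
  have hs (x : Finset ι) (hx : x ⊆ s ∪ t) (y : ∀ i, T.obj₃ ⟶ A i) :
      ∑ i ∈ s ∪ t, (if i ∈ x then y i else 0) ≫ c.inj i = ∑ i ∈ x, y i ≫ c.inj i := by
    simp only [ite_comp, zero_comp, Finset.sum_ite_mem, Finset.inter_eq_right.2 hx]
  simp only [Preadditive.add_comp, Finset.sum_add_distrib]
  rw [hs s Finset.subset_union_left, hs t Finset.subset_union_right]
  conv_lhs => rw [h1, hl]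
  simp only [p, Preadditive.comp_sum, Category.assoc]

lemma IsCompactObj.ext₂ {T : Triangle K} (hT : T ∈ distTriang K) (h₁ : IsCompactObj T.obj₁)
    (h₃ : IsCompactObj T.obj₃) : IsCompactObj T.obj₂ :=
  IsCompactObj.ext₃ (inv_rot_of_distTriang _ hT) (h₃.shift (-1)) h₁

lemma IsCompactObj.ext₁ {T : Triangle K} (hT : T ∈ distTriang K) (h₂ : IsCompactObj T.obj₂)
    (h₃ : IsCompactObj T.obj₃) : IsCompactObj T.obj₁ :=
  IsCompactObj.ext₂ (inv_rot_of_distTriang _ hT) (h₃.shift (-1)) h₂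

end Triangulated

end NCHopkins

/-! ### Localizing classes, telescopes and Bousfield localization -/

namespace NCHopkins

section Auxiliary

variable {K : Type u} [Category.{v} K] [Preadditive K]

/-- All morphisms from objects of `S` to `X` that are killed by `f` factor through one morphism from
a coproduct of objects of `S` that is killed by `f`. -/
lemma exists_coproduct_factorization [HasCoproducts.{v} K] (S : ObjectProperty K)
    [ObjectProperty.EssentiallySmall.{v} S] {X A : K} (f : X ⟶ A) :
    ∃ (ι : Type v) (D : ι → K) (c : Cofan D) (_ : IsColimit c) (t : c.pt ⟶ X),
      (∀ i, S (D i)) ∧ t ≫ f = 0 ∧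
      ∀ C, S C → ∀ h : C ⟶ X, h ≫ f = 0 → ∃ g : C ⟶ c.pt, g ≫ t = h := by
  obtain ⟨Q, _, hQS, hSQ⟩ := ObjectProperty.EssentiallySmall.exists_small_le.{v} S
  let G : Shrink.{v} (Subtype Q) → K := fun j => ((equivShrink (Subtype Q)).symm j).1
  let ι : Type v := Σ j : Shrink.{v} (Subtype Q), {h : G j ⟶ X // h ≫ f = 0}
  let D : ι → K := fun i => G i.1
  let c : Cofan D := Cofan.mk _ (Sigma.ι D)
  have hc : IsColimit c := coproductIsCoproduct D
  let t : c.pt ⟶ X := Cofan.IsColimit.desc hc fun i => i.2.1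
  have ht (i : ι) : c.inj i ≫ t = i.2.1 := Cofan.IsColimit.fac hc _ _
  refine ⟨ι, D, c, hc, t, fun i => hQS _ ((equivShrink (Subtype Q)).symm i.1).2, ?_, ?_⟩
  · refine Cofan.IsColimit.hom_ext hc _ _ fun i => ?_
    rw [← Category.assoc, ht, i.2.2, comp_zero]
  · intro C hC h hh
    obtain ⟨C', hC', ⟨e⟩⟩ := hSQ C hC
    obtain ⟨j, hj⟩ : ∃ j, G j = C' :=
      ⟨equivShrink _ ⟨C', hC'⟩, by simp [G]⟩
    subst hj
    refine ⟨e.hom ≫ c.inj ⟨j, e.inv ≫ h, by rw [Category.assoc, hh, comp_zero]⟩, ?_⟩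
    rw [Category.assoc, ht, Iso.hom_inv_id_assoc]

/-- A morphism to a suspension comes from a morphism out of a desuspension. -/
lemma exists_eq_shift_map {K : Type u} [Category.{v} K] [HasShift K ℤ] {C S : K}
    (k : C ⟶ S⟦(1 : ℤ)⟧) :
    ∃ (e : C ≅ (C⟦(-1 : ℤ)⟧)⟦(1 : ℤ)⟧) (k' : C⟦(-1 : ℤ)⟧ ⟶ S), k = e.hom ≫ k'⟦(1 : ℤ)⟧' := by
  let e : C ≅ (C⟦(-1 : ℤ)⟧)⟦(1 : ℤ)⟧ := ((shiftEquiv K (1 : ℤ)).counitIso.app C).symm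
  obtain ⟨k', hk'⟩ := (shiftFunctor K (1 : ℤ)).map_surjective (e.inv ≫ k)
  exact ⟨e, k', by rw [hk', Iso.hom_inv_id_assoc]⟩

/-- If `δ` is a monomorphism as seen from the desuspension of `C`, then `δ⟦1⟧` is a monomorphism as
seen from `C`. -/
lemma eq_zero_of_comp_shift_map [HasShift K ℤ]
    [∀ n : ℤ, (shiftFunctor K n).Additive] {C S T : K} {δ : S ⟶ T}
    (hδ : ∀ k : C⟦(-1 : ℤ)⟧ ⟶ S, k ≫ δ = 0 → k = 0)
    (k : C ⟶ S⟦(1 : ℤ)⟧) (hk : k ≫ δ⟦(1 : ℤ)⟧' = 0) : k = 0 := by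
  obtain ⟨e, k', rfl⟩ := exists_eq_shift_map k
  have : k' ≫ δ = 0 := by
    apply (shiftFunctor K (1 : ℤ)).map_injective
    rw [Functor.map_comp, Functor.map_zero, ← cancel_epi e.hom, ← Category.assoc, hk, comp_zero]
  rw [hδ k' this, Functor.map_zero, comp_zero]

end Auxiliary

section Localizing

variable {K : Type u} [Category.{v} K] [Preadditive K] [HasZeroObject K] [HasShift K ℤ]
  [∀ n : ℤ, (shiftFunctor K n).Additive] [Pretriangulated K]

/-- A localizing class of objects: a triangulated subcategory closed under set-indexed coproducts.
Closure under isomorphisms is the case of a coproduct with one summand. -/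
structure IsLocalizingClass (P : ObjectProperty K) : Prop where
  shift : ∀ (M : K) (n : ℤ), P M → P (M⟦n⟧)
  ext₂ : ∀ T ∈ distTriang K, P T.obj₁ → P T.obj₃ → P T.obj₂
  coproduct : ∀ (ι : Type v) (A : ι → K) (c : Cofan A), Nonempty (IsColimit c) →
    (∀ i, P (A i)) → P c.pt

namespace IsLocalizingClass

variable {P : ObjectProperty K}

lemma of_iso (hP : IsLocalizingClass P) {M N : K} (e : M ≅ N) (hM : P M) : P N :=
  hP.coproduct PUnit (fun _ => M) (Cofan.mk N fun _ => e.hom)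
    ⟨Cofan.IsColimit.mk _ (fun s => e.inv ≫ s.inj PUnit.unit) (by simp)
      (fun s m hm => by simp [← hm PUnit.unit])⟩ fun _ => hM

lemma ext₃ (hP : IsLocalizingClass P) (T : Triangle K) (hT : T ∈ distTriang K) (h₁ : P T.obj₁)
    (h₂ : P T.obj₂) : P T.obj₃ :=
  hP.ext₂ _ (rot_of_distTriang _ hT) h₂ (hP.shift _ _ h₁)

lemma ext₁ (hP : IsLocalizingClass P) (T : Triangle K) (hT : T ∈ distTriang K) (h₂ : P T.obj₂)
    (h₃ : P T.obj₃) : P T.obj₁ :=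
  hP.ext₂ _ (inv_rot_of_distTriang _ hT) (hP.shift _ (-1) h₃) h₂

/-- The preimage of a localizing class under an exact functor that preserves coproducts. -/
lemma inverseImage (hP : IsLocalizingClass P) {F : K ⥤ K} (hF : IsExactFunctor F)
    (hF' : ∀ ι : Type v, PreservesColimitsOfShape (Discrete ι) F) :
    IsLocalizingClass fun M => P (F.obj M) := by
  obtain ⟨_, _⟩ := hF
  refine ⟨fun M n h => ?_, fun T hT h₁ h₃ => ?_, fun ι A c ⟨hc⟩ h => ?_⟩
  · exact hP.of_iso ((F.commShiftIso n).app M).symm (hP.shift _ n h)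
  · exact hP.ext₂ _ (F.map_distinguished _ hT) h₁ h₃
  · have := hF' ι
    exact hP.coproduct ι _ _ ⟨isColimitMapCofan F hc⟩ h

end IsLocalizingClass

/-- The mapping telescope (homotopy colimit) of a sequence: the cone of `1 - shift` on the coproduct
of its terms. It is a weak colimit, compact objects see it as the colimit, and it belongs to every
localizing class that contains the terms. -/
lemma exists_telescope [HasCoproducts.{v} K] (X : ℕ → K) (u : ∀ n, X n ⟶ X (n + 1)) :
    ∃ (E : K) (i : ∀ n, X n ⟶ E), (∀ n, u n ≫ i (n + 1) = i n) ∧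
      (∀ (A : K) (f : ∀ n, X n ⟶ A), (∀ n, u n ≫ f (n + 1) = f n) →
        ∃ φ : E ⟶ A, ∀ n, i n ≫ φ = f n) ∧
      (∀ C, IsCompactObj C → ∀ h : C ⟶ E, ∃ (n : ℕ) (g : C ⟶ X n), h = g ≫ i n) ∧
      ∀ P : ObjectProperty K, IsLocalizingClass P → (∀ n, P (X n)) → P E := by
  classical
  let A : ULift.{v} ℕ → K := fun n => X n.down
  let c : Cofan A := Cofan.mk _ (Sigma.ι A)
  have hc : IsColimit c := coproductIsCoproduct A
  let σ : c.pt ⟶ c.pt := Cofan.IsColimit.desc hc fun n => u n.down ≫ c.inj ⟨n.down + 1⟩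
  have hσ (n : ℕ) : c.inj ⟨n⟩ ≫ σ = u n ≫ c.inj ⟨n + 1⟩ := Cofan.IsColimit.fac hc _ _
  let δ : c.pt ⟶ c.pt := 𝟙 _ - σ
  obtain ⟨E, p, w, hT⟩ := distinguished_cocone_triangle δ
  have hδp : σ ≫ p = p := by
    have : δ ≫ p = 0 := comp_distTriang_mor_zero₁₂ _ hT
    rw [Preadditive.sub_comp, Category.id_comp, sub_eq_zero] at this
    exact this.symm
  have hi (n : ℕ) : u n ≫ c.inj ⟨n + 1⟩ ≫ p = c.inj ⟨n⟩ ≫ p := by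
    rw [← Category.assoc, ← hσ, Category.assoc, hδp]
  -- A morphism from a compact object killed by `1 - σ` vanishes: its components vanish one by one.
  have hinj (C : K) (hC : IsCompactObj C) (h : C ⟶ c.pt) (hh : h ≫ δ = 0) : h = 0 := by
    have hh' : h = h ≫ σ := by
      rwa [Preadditive.comp_sub, Category.comp_id, sub_eq_zero] at hh
    have h0 (n : ℕ) : h ≫ cofanProj hc ⟨n⟩ = 0 := by
      induction n with
      | zero =>
        have : σ ≫ cofanProj hc ⟨0⟩ = 0 := by
          refine Cofan.IsColimit.hom_ext hc _ _ fun ⟨m⟩ => ?_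
          rw [← Category.assoc, hσ, Category.assoc, inj_cofanProj_of_ne hc (by simp), comp_zero,
            comp_zero]
        rw [hh', Category.assoc, this, comp_zero]
      | succ n ih =>
        have : σ ≫ cofanProj hc ⟨n + 1⟩ = cofanProj hc ⟨n⟩ ≫ u n := by
          refine Cofan.IsColimit.hom_ext hc _ _ fun ⟨m⟩ => ?_
          rw [← Category.assoc, hσ, Category.assoc, ← Category.assoc (c.inj _)]
          by_cases hm : m = n
          · subst hm
            rw [inj_cofanProj_self, inj_cofanProj_self]
            exact (Category.comp_id _).trans (Category.id_comp _).symm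
          · rw [inj_cofanProj_of_ne hc (by simpa using hm),
              inj_cofanProj_of_ne hc (by simpa using hm), comp_zero, zero_comp]
        rw [hh', Category.assoc, this, ← Category.assoc, ih, zero_comp]
    obtain ⟨s, g, rfl⟩ := hC.exists_eq_sum hc h
    refine Finset.sum_eq_zero fun j hj => ?_
    have := h0 j.down
    rw [sum_inj_cofanProj, if_pos hj] at this
    rw [show g j = 0 from this, zero_comp]
  refine ⟨E, fun n => c.inj ⟨n⟩ ≫ p, hi, fun B f hf => ?_, fun C hC h => ?_, fun P hP hX => ?_⟩
  · let F : c.pt ⟶ B := Cofan.IsColimit.desc hc fun n => f n.down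
    have hF (n : ULift.{v} ℕ) : c.inj n ≫ F = f n.down := Cofan.IsColimit.fac hc _ _
    obtain ⟨φ, hφ⟩ := Triangle.yoneda_exact₂ _ hT F (by
      change δ ≫ F = 0
      rw [Preadditive.sub_comp, Category.id_comp, sub_eq_zero]
      refine Cofan.IsColimit.hom_ext hc _ _ fun ⟨n⟩ => ?_
      rw [← Category.assoc, hσ, Category.assoc, hF, hF, hf])
    refine ⟨φ, fun n => ?_⟩
    have hφ' : c.inj ⟨n⟩ ≫ p ≫ φ = c.inj ⟨n⟩ ≫ F := congrArg _ hφ.symm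
    exact (Category.assoc _ _ _).trans (hφ'.trans (hF ⟨n⟩))
  · have hw : h ≫ w = 0 := by
      refine eq_zero_of_comp_shift_map (δ := δ) (hinj _ (hC.shift _)) _ ?_
      rw [Category.assoc, show w ≫ δ⟦(1 : ℤ)⟧' = 0 from comp_distTriang_mor_zero₃₁ _ hT, comp_zero]
    obtain ⟨k, hk⟩ : ∃ k : C ⟶ c.pt, h = k ≫ p := Triangle.coyoneda_exact₃ _ hT h hw
    obtain ⟨s, g, rfl⟩ := hC.exists_eq_sum hc k
    have htrans (n m : ℕ) (hnm : n ≤ m) :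
        ∃ t : X n ⟶ X m, t ≫ c.inj ⟨m⟩ ≫ p = c.inj ⟨n⟩ ≫ p := by
      induction m, hnm using Nat.le_induction with
      | base => exact ⟨𝟙 _, Category.id_comp _⟩
      | succ m _ ih =>
        obtain ⟨t, ht⟩ := ih
        exact ⟨t ≫ u m, by rw [Category.assoc, hi, ht]⟩
    let N := s.sup fun j => j.down
    have hN (j : ULift.{v} ℕ) (hj : j ∈ s) : ∃ t : C ⟶ X N, t ≫ c.inj ⟨N⟩ ≫ p =
        (g j ≫ c.inj j) ≫ p := by
      obtain ⟨t, ht⟩ := htrans j.down N (Finset.le_sup (f := fun j : ULift.{v} ℕ => j.down) hj)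
      exact ⟨g j ≫ t, by rw [Category.assoc, ht, Category.assoc]⟩
    choose! t ht using hN
    refine ⟨N, ∑ j ∈ s, t j, ?_⟩
    change h = (∑ j ∈ s, t j) ≫ c.inj ⟨N⟩ ≫ p
    rw [hk, Preadditive.sum_comp, Preadditive.sum_comp]
    exact Finset.sum_congr rfl fun j hj => (ht j hj).symm
  · have hcP : P c.pt := hP.coproduct _ _ c ⟨hc⟩ fun n => hX n.down
    exact hP.ext₃ _ hT hcP hcP

/-- The objects obtained from coproducts of objects of `S` by finitely many extensions. -/
inductive IsCellular (S : ObjectProperty K) : ObjectProperty K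
  | coproduct {ι : Type v} (A : ι → K) (c : Cofan A) (hc : IsColimit c) (hA : ∀ i, S (A i)) :
      IsCellular S c.pt
  | ext (T : Triangle K) (hT : T ∈ distTriang K) (h₁ : IsCellular S T.obj₁)
      (h₃ : IsCellular S T.obj₃) : IsCellular S T.obj₂

lemma IsLocalizingClass.of_isCellular {P S : ObjectProperty K} (hP : IsLocalizingClass P)
    (hS : S ≤ P) {X : K} (hX : IsCellular S X) : P X := by
  induction hX with
  | coproduct A c hc hA => exact hP.coproduct _ A c ⟨hc⟩ fun i => hS _ (hA i)
  | ext T hT _ _ h₁ h₃ => exact hP.ext₂ T hT h₁ h₃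

/-- Bousfield localization away from a set `S` of compact objects closed under shifts: every object
`A` sits in a triangle `E ⟶ A ⟶ L ⟶ E⟦1⟧` such that `L` receives only zero morphisms from `S`, and
`E`, a telescope of cellular objects, is in the localizing class generated by `S`. The terms of
the telescope are built by coning off everything that dies in `A`. -/
theorem exists_bousfield_triangle [HasCoproducts.{v} K] (S : ObjectProperty K)
    [ObjectProperty.EssentiallySmall.{v} S] (hS : S ≤ IsCompactObj)
    (hshift : ∀ (C : K) (n : ℤ), S C → S (C⟦n⟧)) (A : K) :
    ∃ (E L : K) (a : E ⟶ A) (b : A ⟶ L) (d : L ⟶ E⟦(1 : ℤ)⟧), Triangle.mk a b d ∈ distTriang K ∧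
      (∀ C, S C → ∀ h : C ⟶ L, h = 0) ∧
      (∀ P : ObjectProperty K, IsLocalizingClass P → S ≤ P → P E) ∧
      ∀ C, IsCompactObj C → ∀ h : C ⟶ E,
        ∃ X, IsCellular S X ∧ ∃ (g : C ⟶ X) (i : X ⟶ E), h = g ≫ i := by
  let V := {p : Σ X : K, (X ⟶ A) // IsCellular S p.1}
  have hstep (p : V) : ∃ (q : V) (u : p.1.1 ⟶ q.1.1), u ≫ q.1.2 = p.1.2 ∧
      ∀ C, S C → ∀ h : C ⟶ p.1.1, h ≫ p.1.2 = 0 → h ≫ u = 0 := by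
    obtain ⟨⟨X, f⟩, hX⟩ := p
    obtain ⟨ι, D, c, hc, t, hD, htf, ht⟩ := exists_coproduct_factorization S f
    obtain ⟨X', u, w, hT⟩ := distinguished_cocone_triangle t
    obtain ⟨f', hf'⟩ := Triangle.yoneda_exact₂ _ hT f htf
    refine ⟨⟨⟨X', f'⟩, ?_⟩, u, hf'.symm, ?_⟩
    · exact IsCellular.ext _ (rot_of_distTriang _ hT) hX
        (IsCellular.coproduct _ _ (isColimitMapCofan (shiftFunctor K (1 : ℤ)) hc)
          fun i => hshift _ _ (hD i))
    · intro C hC h hh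
      obtain ⟨g, rfl⟩ := ht C hC h hh
      rw [Category.assoc, show t ≫ u = 0 from comp_distTriang_mor_zero₁₂ _ hT, comp_zero]
  choose next u hu hkill using hstep
  obtain ⟨ι, D, c, hc, t, hD, -, ht⟩ := exists_coproduct_factorization S (0 : A ⟶ A)
  let p₀ : V := ⟨⟨c.pt, t⟩, IsCellular.coproduct D c hc hD⟩
  let p : ℕ → V := fun n => Nat.rec p₀ (fun _ => next) n
  obtain ⟨E, i, hi, huniv, hfac, hloc⟩ := exists_telescope (fun n => (p n).1.1) (fun n => u (p n))
  obtain ⟨φ, hφ⟩ := huniv A (fun n => (p n).1.2) (fun n => hu (p n))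
  have hui (n : ℕ) (C : K) (hC : S C) (h : C ⟶ (p n).1.1) (hh : h ≫ (p n).1.2 = 0) :
      h ≫ i n = 0 := by
    rw [← hi n, ← Category.assoc, hkill (p n) C hC h hh, zero_comp]
  have hinj (C : K) (hC : S C) (h : C ⟶ E) (hh : h ≫ φ = 0) : h = 0 := by
    obtain ⟨n, g, rfl⟩ := hfac C (hS _ hC) h
    exact hui n C hC g (by rw [← hφ n, ← Category.assoc, hh])
  obtain ⟨L, b, d, hT⟩ := distinguished_cocone_triangle φ
  refine ⟨E, L, φ, b, d, hT, fun C hC h => ?_, fun P hP hSP => ?_, fun C hC h => ?_⟩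
  · have hd : h ≫ d = 0 := by
      refine eq_zero_of_comp_shift_map (δ := φ) (hinj _ (hshift _ _ hC)) _ ?_
      rw [Category.assoc, show d ≫ φ⟦(1 : ℤ)⟧' = 0 from comp_distTriang_mor_zero₃₁ _ hT, comp_zero]
    obtain ⟨k, hk⟩ : ∃ k : C ⟶ A, h = k ≫ b := Triangle.coyoneda_exact₃ _ hT h hd
    obtain ⟨g, hg⟩ := ht C hC k comp_zero
    have hφb : φ ≫ b = 0 := comp_distTriang_mor_zero₁₂ _ hT
    have ht' : t = i 0 ≫ φ := (hφ 0).symm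
    rw [hk, ← hg, ht', Category.assoc, Category.assoc, hφb, comp_zero, comp_zero]
  · exact hloc P hP fun n => hP.of_isCellular hSP (p n).2
  · obtain ⟨n, g, hg⟩ := hfac C hC h
    exact ⟨_, (p n).2, g, i n, hg⟩

end Localizing

end NCHopkins

/-! ### Thick ideals, orthogonals and rigidity -/

namespace NCHopkins

section Ideals

open scoped ZeroObject

variable {K : Type u} [Category.{v} K] [Preadditive K]

lemma isZero_of_retract {M P : K} (h : Retract M P) (hP : IsZero P) : IsZero M := by
  rw [IsZero.iff_id_eq_zero, ← h.retract, hP.eq_of_tgt h.i 0, zero_comp]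

lemma isCompactObj_of_isZero {Z : K} (hZ : IsZero Z) : IsCompactObj Z :=
  isCompactObj_of_exists_eq_sum fun _ _ _ _ _ => ⟨∅, fun _ => 0, hZ.eq_of_src _ _⟩

variable [HasZeroObject K] [HasShift K ℤ] [∀ n : ℤ, (shiftFunctor K n).Additive]
  [Pretriangulated K]

/-- A direct summand, as a retract. -/
noncomputable def retractOfIsoBiprod {M N P : K} (e : P ≅ M ⊞ N) : Retract M P where
  i := biprod.inl ≫ e.inv
  r := e.hom ≫ biprod.fst

/-- A retract is a direct summand, the complement being the cone of the inclusion. -/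
lemma exists_triangle_of_retract {M P : K} (h : Retract M P) :
    ∃ (N : K) (b : P ⟶ N) (d : N ⟶ M⟦(1 : ℤ)⟧), Triangle.mk h.i b d ∈ distTriang K ∧
      Nonempty (P ≅ M ⊞ N) := by
  obtain ⟨N, b, d, hT⟩ := distinguished_cocone_triangle h.i
  have : d = 0 := by
    refine (Triangle.mor₃_eq_zero_iff_mono₁ _ hT).2 ?_
    change Mono h.i
    infer_instance
  obtain ⟨e, -⟩ := exists_iso_binaryBiproduct_of_distTriang _ hT this
  exact ⟨N, b, d, hT, ⟨e⟩⟩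

lemma isLocalizingClass_isZero : IsLocalizingClass (IsZero (C := K)) where
  shift _ n h := (shiftFunctor K n).map_isZero h
  ext₂ T hT h₁ h₃ := Triangle.isZero₂_of_isZero₁₃ T hT h₁ h₃
  coproduct _ A c := fun ⟨hc⟩ h => by
    rw [IsZero.iff_id_eq_zero]
    exact Cofan.IsColimit.hom_ext hc _ _ fun i => (h i).eq_of_src _ _

lemma isLocalizingClass_leftOrthogonal (S : ObjectProperty K) [S.IsStableUnderShift ℤ] :
    IsLocalizingClass S.leftOrthogonal where
  shift _ n h := ObjectProperty.le_shift S.leftOrthogonal n _ h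
  ext₂ T hT h₁ h₃ := ObjectProperty.ext_of_isTriangulatedClosed₂ S.leftOrthogonal T hT h₁ h₃
  coproduct _ _ c := fun ⟨hc⟩ h _ f hC => Cofan.IsColimit.hom_ext hc _ _ fun i => by
    rw [h i (c.inj i ≫ f) hC, comp_zero]

/-- The objects receiving only zero morphisms from a shift-stable class of compact objects form a
localizing class. -/
lemma isLocalizingClass_rightOrthogonal {S : ObjectProperty K} [S.IsStableUnderShift ℤ]
    (hS : S ≤ IsCompactObj) : IsLocalizingClass S.rightOrthogonal where
  shift _ n h := ObjectProperty.le_shift S.rightOrthogonal n _ h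
  ext₂ T hT h₁ h₃ := ObjectProperty.ext_of_isTriangulatedClosed₂ S.rightOrthogonal T hT h₁ h₃
  coproduct ι A c := fun ⟨hc⟩ h C f hC => by
    obtain ⟨s, g, rfl⟩ := (hS _ hC).exists_eq_sum hc f
    exact Finset.sum_eq_zero fun i _ => by rw [h i (g i) hC, zero_comp]

lemma IsExactFunctor.additive {F : K ⥤ K} (hF : IsExactFunctor F) : F.Additive := by
  obtain ⟨_, _⟩ := hF
  infer_instance

variable [MonoidalCategory K]

/-- The class of all objects is a thick ideal of itself. -/
lemma isThickIdealOf_top_top : IsThickIdealOf (⊤ : ObjectProperty K) ⊤ := by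
  constructor <;> simp

lemma thickIdealOf_self (A : ObjectProperty K) (M : K) : thickIdealOf A M M := fun _ _ h => h

lemma thickIdealOf_le {A I : ObjectProperty K} (hI : IsThickIdealOf A I) {M : K} (hM : I M) :
    thickIdealOf A M ≤ I := fun _ h => h I hI hM

lemma isThickIdealOf_thickIdealOf {A : ObjectProperty K} (hA : IsThickIdealOf A A) {M : K}
    (hM : A M) : IsThickIdealOf A (thickIdealOf A M) where
  le := thickIdealOf_le hA hM
  nonempty := ⟨M, thickIdealOf_self A M⟩
  shift N n h I hI hIM := hI.shift N n (h I hI hIM)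
  ext₁ T hT hA h₂ h₃ I hI hIM := hI.ext₁ T hT hA (h₂ I hI hIM) (h₃ I hI hIM)
  ext₂ T hT hA h₁ h₃ I hI hIM := hI.ext₂ T hT hA (h₁ I hI hIM) (h₃ I hI hIM)
  ext₃ T hT hA h₁ h₂ I hI hIM := hI.ext₃ T hT hA (h₁ I hI hIM) (h₂ I hI hIM)
  summand N N' P hN hN' hP e :=
    ⟨fun I hI hIM => (hI.summand N N' P hN hN' (hP I hI hIM) e).1,
      fun I hI hIM => (hI.summand N N' P hN hN' (hP I hI hIM) e).2⟩
  tensor_left N B hB h I hI hIM := hI.tensor_left N B hB (h I hI hIM)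
  tensor_right N B hB h I hI hIM := hI.tensor_right N B hB (h I hI hIM)

/-- A localizing class that is closed under retracts and under tensoring on either side is a thick
ideal. -/
lemma IsLocalizingClass.isThickIdealOf_top {P : ObjectProperty K} (hP : IsLocalizingClass P)
    (hretract : ∀ M N : K, Retract M N → P N → P M)
    (hleft : ∀ M B : K, P M → P (B ⊗ M)) (hright : ∀ M B : K, P M → P (M ⊗ B)) :
    IsThickIdealOf ⊤ P where
  le := le_top
  nonempty := ⟨_, hP.coproduct PEmpty PEmpty.elim (Cofan.mk 0 fun i => i.elim)
    ⟨Cofan.IsColimit.mk _ (fun _ => 0) (fun _ i => i.elim)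
      (fun _ _ _ => (isZero_zero K).eq_of_src _ _)⟩ fun i => i.elim⟩
  shift := hP.shift
  ext₁ T hT _ := hP.ext₁ T hT
  ext₂ T hT _ := hP.ext₂ T hT
  ext₃ T hT _ := hP.ext₃ T hT
  summand M N _ _ _ hQ := fun ⟨e⟩ =>
    ⟨hretract _ _ (retractOfIsoBiprod e) hQ,
      hretract _ _ (retractOfIsoBiprod (e ≪≫ biprod.braiding M N)) hQ⟩
  tensor_left M B _ := hleft M B
  tensor_right M B _ := hright M B

/-- The intersection of a thick ideal of `K` with `A` is a thick ideal of `A`. Here `M` witnesses that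
the intersection is non-empty. -/
lemma IsThickIdealOf.inf {A J : ObjectProperty K} (hA : IsThickIdealOf A A)
    (hJ : IsThickIdealOf ⊤ J) {M : K} (hAM : A M) (hJM : J M) : IsThickIdealOf A (A ⊓ J) where
  le := inf_le_left
  nonempty := ⟨M, hAM, hJM⟩
  shift N n h := ⟨hA.shift N n h.1, hJ.shift N n h.2⟩
  ext₁ T hT h h₂ h₃ := ⟨h, hJ.ext₁ T hT trivial h₂.2 h₃.2⟩
  ext₂ T hT h h₁ h₃ := ⟨h, hJ.ext₂ T hT trivial h₁.2 h₃.2⟩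
  ext₃ T hT h h₁ h₂ := ⟨h, hJ.ext₃ T hT trivial h₁.2 h₂.2⟩
  summand N N' P hN hN' hP e :=
    have := hJ.summand N N' P trivial trivial hP.2 e
    ⟨⟨hN, this.1⟩, ⟨hN', this.2⟩⟩
  tensor_left N B hB h := ⟨hA.tensor_left N B hB h.1, hJ.tensor_left N B trivial h.2⟩
  tensor_right N B hB h := ⟨hA.tensor_right N B hB h.1, hJ.tensor_right N B trivial h.2⟩

namespace IsThickIdealOf

variable {I : ObjectProperty K}

/-- A thick ideal of compact objects is a triangulated subcategory in the sense of Mathlib. -/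
lemma isTriangulated (hI : IsThickIdealOf IsCompactObj I) : I.IsTriangulated :=
  { exists_zero := by
      obtain ⟨M, hM⟩ := hI.nonempty
      exact ⟨0, isZero_zero K, hI.ext₃ _ (contractible_distinguished M)
        (isCompactObj_of_isZero (isZero_zero K)) hM hM⟩
    isStableUnderShiftBy := fun n => ⟨fun M h => hI.shift M n h⟩
    ext₂' := fun T hT h₁ h₃ => I.le_isoClosure _
      (hI.ext₂ T hT (IsCompactObj.ext₂ hT (hI.le _ h₁) (hI.le _ h₃)) h₁ h₃) }

lemma of_retract (hI : IsThickIdealOf IsCompactObj I) {N D : K} (hN : IsCompactObj N) (hD : I D)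
    (h : Retract N D) : I N := by
  obtain ⟨Z, b, d, hT, e⟩ := exists_triangle_of_retract h
  exact (hI.summand N Z D hN (IsCompactObj.ext₃ hT hN (hI.le _ hD)) hD e).1

/-- A morphism from a compact object `C` to a cellular object over a thick ideal `I` of compact
objects can be killed by a morphism `C' ⟶ C` with cone in `I`. -/
lemma exists_trW_comp_eq_zero [IsTriangulated K] (hI : IsThickIdealOf IsCompactObj I) {X : K}
    (hX : IsCellular I X) {C : K} (hC : IsCompactObj C) (g : C ⟶ X) :
    ∃ (C' : K) (a : C' ⟶ C), IsCompactObj C' ∧ I.trW a ∧ a ≫ g = 0 := by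
  have := hI.isTriangulated
  induction hX generalizing C with
  | @coproduct ι A c hc hA =>
    classical
    obtain ⟨s, g, rfl⟩ := hC.exists_eq_sum hc g
    suffices ∃ (C' : K) (a : C' ⟶ C), IsCompactObj C' ∧ I.trW a ∧ ∀ i ∈ s, a ≫ g i = 0 by
      obtain ⟨C', a, hC', ha, h⟩ := this
      refine ⟨C', a, hC', ha, ?_⟩
      rw [Preadditive.comp_sum]
      exact Finset.sum_eq_zero fun i hi => by rw [← Category.assoc, h i hi, zero_comp]
    induction s using Finset.induction_on with
    | empty => exact ⟨C, 𝟙 C, hC, MorphismProperty.id_mem _ C, by simp⟩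
    | insert i s _ ih =>
      obtain ⟨C', a, hC', ha, h⟩ := ih
      obtain ⟨C'', a', d, hT⟩ := distinguished_cocone_triangle₁ (a ≫ g i)
      have h0 : a' ≫ a ≫ g i = 0 := comp_distTriang_mor_zero₁₂ _ hT
      refine ⟨C'', a' ≫ a, IsCompactObj.ext₁ hT hC' (hI.le _ (hA i)),
        MorphismProperty.comp_mem _ _ _ ⟨_, _, _, hT, hA i⟩ ha, fun j hj => ?_⟩
      rw [Category.assoc]
      rcases Finset.mem_insert.1 hj with rfl | hj
      · exact h0
      · rw [h j hj, comp_zero]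
  | ext T hT _ _ ih₁ ih₃ =>
    obtain ⟨C₁, a₁, hC₁, ha₁, h₁⟩ := ih₃ hC (g ≫ T.mor₂)
    obtain ⟨k, hk⟩ := Triangle.coyoneda_exact₂ T hT (a₁ ≫ g) (by rw [Category.assoc, h₁])
    obtain ⟨C₂, a₂, hC₂, ha₂, h₂⟩ := ih₁ hC₁ k
    exact ⟨C₂, a₂ ≫ a₁, hC₂, MorphismProperty.comp_mem _ _ _ ha₂ ha₁, by
      rw [Category.assoc, hk, ← Category.assoc, h₂, zero_comp]⟩

/-- A compact retract of a cellular object over a thick ideal `I` of compact objects is in `I`. -/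
lemma of_retract_isCellular [IsTriangulated K] (hI : IsThickIdealOf IsCompactObj I) {X N : K}
    (hX : IsCellular I X) (hN : IsCompactObj N) (h : Retract N X) : I N := by
  obtain ⟨N', a, -, ⟨D, b, d, hT, hD⟩, ha⟩ := hI.exists_trW_comp_eq_zero hX hN h.i
  have ha0 : a = 0 := by
    rw [← Category.comp_id a, ← h.retract, ← Category.assoc, ha, zero_comp]
  obtain ⟨r, hr⟩ : ∃ r : D ⟶ N, 𝟙 N = b ≫ r :=
    Triangle.yoneda_exact₂ _ hT (𝟙 N) ((Category.comp_id a).trans ha0)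
  exact hI.of_retract hN hD { i := b, r := r, retract := hr.symm }

end IsThickIdealOf

end Ideals

section CompactlyGenerated

variable {K : Type u} [Category.{v} K] [Preadditive K] [HasZeroObject K] [HasShift K ℤ]
  [∀ n : ℤ, (shiftFunctor K n).Additive] [Pretriangulated K] [MonoidalCategory K]

namespace IsCompactlyGeneratedMonoidal

lemma isThickIdealOf_isCompactObj (hK : IsCompactlyGeneratedMonoidal K) :
    IsThickIdealOf (IsCompactObj (K := K)) IsCompactObj where
  le := le_rfl
  nonempty := ⟨_, hK.compact_unit⟩
  shift _ n h := h.shift n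
  ext₁ _ _ h _ _ := h
  ext₂ _ _ h _ _ := h
  ext₃ _ _ h _ _ := h
  summand _ _ _ hM hN _ _ := ⟨hM, hN⟩
  tensor_left _ _ hB hM := hK.compact_tensor _ _ hB hM
  tensor_right _ _ hB hM := hK.compact_tensor _ _ hM hB

lemma tensorLeft_additive (hK : IsCompactlyGeneratedMonoidal K) (A : K) :
    (tensorLeft A).Additive := (hK.exact_tensorLeft A).additive

lemma tensorRight_additive (hK : IsCompactlyGeneratedMonoidal K) (A : K) :
    (tensorRight A).Additive := (hK.exact_tensorRight A).additive

lemma isCompactObj_rightDual (hK : IsCompactlyGeneratedMonoidal K) (A B : K) [ExactPairing A B] :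
    IsCompactObj B := by
  have := hK.tensorLeft_additive B
  exact (hK.compact_unit.map_leftAdjoint (tensorLeftAdjunction A B)
    (hK.tensorLeft_coproducts A)).of_iso (ρ_ B)

lemma isCompactObj_leftDual (hK : IsCompactlyGeneratedMonoidal K) (A B : K) [ExactPairing B A] :
    IsCompactObj B := by
  have := hK.tensorRight_additive B
  exact (hK.compact_unit.map_leftAdjoint (tensorRightAdjunction B A)
    (hK.tensorRight_coproducts A)).of_iso (λ_ B)

lemma isZero_of_forall_eq_zero (hK : IsCompactlyGeneratedMonoidal K) {M : K}
    (h : ∀ C, IsCompactObj C → ∀ f : C ⟶ M, f = 0) : IsZero M := by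
  by_contra hM
  obtain ⟨C, f, hC, hf⟩ := hK.exists_nonzero_hom M hM
  exact hf (h C hC f)

/-- The compact objects generate `K` as a localizing class. -/
lemma of_isLocalizingClass (hK : IsCompactlyGeneratedMonoidal K) {P : ObjectProperty K}
    (hP : IsLocalizingClass P) (h : IsCompactObj ≤ P) (A : K) : P A := by
  have := hK.hasCoproducts
  have := hK.compact_essentiallySmall
  obtain ⟨E, L, a, b, d, hT, hL, hE, -⟩ :=
    exists_bousfield_triangle (IsCompactObj (K := K)) le_rfl (fun C n hC => hC.shift n) A
  have ha : IsIso a := (Triangle.isZero₃_iff_isIso₁ _ hT).1 (hK.isZero_of_forall_eq_zero hL)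
  exact hP.of_iso (asIso a) (hE P hP h)

/-- `A ↦ P (B ⊗ A)` is localizing if `P` is. -/
lemma isLocalizingClass_tensorLeft (hK : IsCompactlyGeneratedMonoidal K) {P : ObjectProperty K}
    (hP : IsLocalizingClass P) (B : K) : IsLocalizingClass fun A => P (B ⊗ A) :=
  hP.inverseImage (hK.exact_tensorLeft B) (hK.tensorLeft_coproducts B)

/-- `A ↦ P (A ⊗ B)` is localizing if `P` is. -/
lemma isLocalizingClass_tensorRight (hK : IsCompactlyGeneratedMonoidal K) {P : ObjectProperty K}
    (hP : IsLocalizingClass P) (B : K) : IsLocalizingClass fun A => P (A ⊗ B) :=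
  hP.inverseImage (hK.exact_tensorRight B) (hK.tensorRight_coproducts B)

/-- The right orthogonal of a thick ideal of compact objects is a thick ideal of `K`. For tensoring
with a compact object this holds by rigidity, and compact objects generate. -/
lemma isThickIdealOf_rightOrthogonal (hK : IsCompactlyGeneratedMonoidal K) {I : ObjectProperty K}
    (hI : IsThickIdealOf IsCompactObj I) : IsThickIdealOf ⊤ I.rightOrthogonal := by
  have := hI.isTriangulated
  have hloc : IsLocalizingClass I.rightOrthogonal := isLocalizingClass_rightOrthogonal hI.le
  refine hloc.isThickIdealOf_top (fun M N r hN C f hC => ?_) (fun B A hB => ?_) fun B A hB => ?_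
  · rw [← Category.comp_id f, ← r.retract, ← Category.assoc, hN (f ≫ r.i) hC, zero_comp]
  · refine hK.of_isLocalizingClass (hK.isLocalizingClass_tensorRight hloc B)
      (fun A hA C f hC => ?_) A
    obtain ⟨-, ⟨_⟩⟩ := hK.rigid A hA
    have hdual := hK.isCompactObj_rightDual A (HasRightDual.rightDual A)
    have hzero (g : HasRightDual.rightDual A ⊗ C ⟶ B) : g = 0 :=
      hB g (hI.tensor_left _ _ hdual hC)
    exact (tensorLeftHomEquiv C A _ B).symm.injective ((hzero _).trans (hzero _).symm)
  · refine hK.of_isLocalizingClass (hK.isLocalizingClass_tensorLeft hloc B)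
      (fun A hA C f hC => ?_) A
    obtain ⟨⟨_⟩, -⟩ := hK.rigid A hA
    have hdual := hK.isCompactObj_leftDual A (HasLeftDual.leftDual A)
    have hzero (g : C ⊗ HasLeftDual.leftDual A ⟶ B) : g = 0 :=
      hB g (hI.tensor_right _ _ hdual hC)
    exact (tensorRightHomEquiv C _ A B).symm.injective ((hzero _).trans (hzero _).symm)

/-- A thick ideal `I` of compact objects annihilates its right orthogonal: a morphism `C ⟶ M ⊗ B`
corresponds to a morphism `M* ⊗ C ⟶ B`, and by the triangle identities `M* ⊗ C` is a retract of
`((M* ⊗ M) ⊗ M*) ⊗ C`, which is in `I`. -/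
lemma isZero_tensor_rightOrthogonal (hK : IsCompactlyGeneratedMonoidal K) {I : ObjectProperty K}
    (hI : IsThickIdealOf IsCompactObj I) {M B : K} (hM : I M) (hB : I.rightOrthogonal B) :
    IsZero (M ⊗ B) := by
  obtain ⟨-, ⟨_⟩⟩ := hK.rigid M (hI.le _ hM)
  let D := HasRightDual.rightDual M
  have hD : IsCompactObj D := hK.isCompactObj_rightDual M D
  have hID : I D := by
    refine hI.of_retract hD (hI.tensor_right _ D hD (hI.tensor_left M D hD hM))
      { i := (ρ_ D).inv ≫ D ◁ η_ M D ≫ (α_ D M D).inv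
        r := ε_ M D ▷ D ≫ (λ_ D).hom
        retract := ?_ }
    have := ExactPairing.coevaluation_evaluation_assoc M D (λ_ D).hom
    simp only [Category.assoc]
    rw [this]
    simp
  refine hK.isZero_of_forall_eq_zero fun C hC f => ?_
  have hzero (g : D ⊗ C ⟶ B) : g = 0 := hB g (hI.tensor_right _ _ hC hID)
  exact (tensorLeftHomEquiv C M D B).symm.injective ((hzero _).trans (hzero _).symm)

/-- The left annihilator of a thick ideal is a thick ideal. -/
lemma isThickIdealOf_annihilator (hK : IsCompactlyGeneratedMonoidal K) {J : ObjectProperty K}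
    (hJ : IsThickIdealOf ⊤ J) : IsThickIdealOf ⊤ fun A => ∀ B, J B → IsZero (A ⊗ B) := by
  have hloc (B : K) := hK.isLocalizingClass_tensorRight isLocalizingClass_isZero B
  refine IsLocalizingClass.isThickIdealOf_top
    ⟨fun M n h B hB => (hloc B).shift M n (h B hB),
      fun T hT h₁ h₃ B hB => (hloc B).ext₂ T hT (h₁ B hB) (h₃ B hB),
      fun ι A c hc h B hB => (hloc B).coproduct ι A c hc fun i => h i B hB⟩
    (fun M N r h B hB => isZero_of_retract (r.map (tensorRight B)) (h B hB))
    (fun M A h B hB => ?_) (fun M A h B hB => ?_)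
  · have := hK.tensorLeft_additive A
    exact ((tensorLeft A).map_isZero (h B hB)).of_iso (α_ A M B)
  · exact (h (A ⊗ B) (hJ.tensor_left B A trivial hB)).of_iso (α_ M A B)

end IsCompactlyGeneratedMonoidal

end CompactlyGenerated

end NCHopkins

/-! ### Supports -/

namespace NCHopkins

section Support

variable {K : Type u} [Category.{v} K] {X : Type w} {σ : K → Set X}

lemma Phi_mono {S T : ObjectProperty K} (h : S ≤ T) : Phi σ S ⊆ Phi σ T :=
  fun _ ⟨A, hA, hx⟩ => ⟨A, h A hA, hx⟩

variable [Preadditive K] [HasZeroObject K] [HasShift K ℤ] [∀ n : ℤ, (shiftFunctor K n).Additive]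
  [Pretriangulated K] [MonoidalCategory K]

namespace IsExtendedWeakSupport

/-- The objects supported in a given subset form a localizing class. -/
lemma isLocalizingClass (hσ : IsExtendedWeakSupport σ) (Y : Set X) :
    IsLocalizingClass fun M => σ M ⊆ Y := by
  have hcoprod (ι : Type v) (A : ι → K) (c : Cofan A) (hc : Nonempty (IsColimit c))
      (h : ∀ i, σ (A i) ⊆ Y) : σ c.pt ⊆ Y := by
    rw [hσ.coproduct ι A c hc]
    exact Set.iUnion_subset h
  have hiso {M N : K} (e : M ≅ N) : σ N = σ M := by
    have hc : IsColimit (Cofan.mk N fun _ : PUnit.{v + 1} => e.hom) :=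
      Cofan.IsColimit.mk _ (fun s => e.inv ≫ s.inj PUnit.unit) (by simp)
        (fun s m hm => by simp [← hm PUnit.unit])
    refine (hσ.coproduct PUnit (fun _ => M) _ ⟨hc⟩).trans ?_
    exact Set.iUnion_const _
  have hshift (M : K) (n : ℤ) : σ (M⟦n⟧) = σ M := by
    induction n using Int.induction_on with
    | zero => exact (hiso ((shiftFunctorZero K ℤ).app M)).symm
    | succ n ih => rw [hiso ((shiftFunctorAdd K (n : ℤ) 1).app M).symm, ← ih]; exact hσ.shift _
    | pred n ih =>
      rw [← ih, ← hσ.shift]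
      exact hiso ((shiftFunctorAdd' K (-(n : ℤ) - 1) 1 (-n) (by ring)).app M)
  refine ⟨fun M n h => ?_, fun T hT h₁ h₃ => ?_, hcoprod⟩
  · rwa [hshift]
  · refine (hσ.triangle _ (rot_of_distTriang _ hT)).trans (Set.union_subset h₃ ?_)
    exact (hσ.shift _).trans_subset h₁

lemma subset_of_retract (hσ : IsExtendedWeakSupport σ) {M P : K} (h : Retract M P) :
    σ M ⊆ σ P := by
  obtain ⟨N, -, -, -, ⟨e⟩⟩ := exists_triangle_of_retract h
  let A : ULift.{v} Bool → K := fun b => bif b.down then M else N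
  let c : Cofan A := Cofan.mk P fun ⟨b⟩ => match b with
    | true => biprod.inl ≫ e.inv
    | false => biprod.inr ≫ e.inv
  have hc : IsColimit c := Cofan.IsColimit.mk _
    (fun s => e.hom ≫ biprod.desc (s.inj ⟨true⟩) (s.inj ⟨false⟩))
    (by rintro s ⟨_ | _⟩ <;> simp [c])
    (fun s m hm => by
      rw [← cancel_epi e.inv, Iso.inv_hom_id_assoc]
      refine biprod.hom_ext' _ _ ?_ ?_
      · exact (Category.assoc _ _ _).symm.trans ((hm ⟨true⟩).trans (biprod.inl_desc _ _).symm)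
      · exact (Category.assoc _ _ _).symm.trans ((hm ⟨false⟩).trans (biprod.inr_desc _ _).symm))
  rw [show σ P = ⋃ i, σ (A i) from hσ.coproduct _ A c ⟨hc⟩]
  exact Set.subset_iUnion (fun i => σ (A i)) ⟨true⟩

/-- For compact `N`, the thick ideals generated by `N` among the compact objects and in `K` have the
same support. Indeed the objects `A` such that `(B ⊗ A) ⊗ C` is supported in `Φ_σ(⟨N⟩)` for all `B`
and `C` form a thick ideal. It contains `N`: this holds by definition for compact `B` and `C`, and
the compact objects generate `K`. -/
lemma Phi_bigIdeal_subset (hσ : IsExtendedWeakSupport σ) (hK : IsCompactlyGeneratedMonoidal K)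
    {N : K} (hN : IsCompactObj N) : Phi σ (bigIdeal N) ⊆ Phi σ (compactIdeal N) := by
  let P : ObjectProperty K := fun M => σ M ⊆ Phi σ (compactIdeal N)
  have hP : IsLocalizingClass P := hσ.isLocalizingClass _
  have hloc (B C : K) : IsLocalizingClass fun A => P ((B ⊗ A) ⊗ C) :=
    hK.isLocalizingClass_tensorLeft (hK.isLocalizingClass_tensorRight hP C) B
  have hQ : IsThickIdealOf ⊤ fun A => ∀ B C, P ((B ⊗ A) ⊗ C) := by
    refine IsLocalizingClass.isThickIdealOf_top
      ⟨fun M n h B C => (hloc B C).shift M n (h B C),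
        fun T hT h₁ h₃ B C => (hloc B C).ext₂ T hT (h₁ B C) (h₃ B C),
        fun ι A c hc h B C => (hloc B C).coproduct ι A c hc fun i => h i B C⟩
      (fun M M' r h B C =>
        (hσ.subset_of_retract ((r.map (tensorLeft B)).map (tensorRight C))).trans (h B C))
      (fun M A h B C => ?_) (fun M A h B C => ?_)
    · exact hP.of_iso (whiskerRightIso (α_ B A M) C) (h (B ⊗ A) C)
    · exact hP.of_iso ((α_ (B ⊗ M) A C).symm ≪≫ whiskerRightIso (α_ B M A) C) (h B (A ⊗ C))
  have hI : IsThickIdealOf IsCompactObj (compactIdeal N) :=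
    isThickIdealOf_thickIdealOf hK.isThickIdealOf_isCompactObj hN
  have hNQ (B C : K) : P ((B ⊗ N) ⊗ C) := by
    refine hK.of_isLocalizingClass (hK.isLocalizingClass_tensorLeft hP (B ⊗ N)) (fun C hC => ?_) C
    refine hK.of_isLocalizingClass (P := fun B => P ((B ⊗ N) ⊗ C))
      (hK.isLocalizingClass_tensorRight (hK.isLocalizingClass_tensorRight hP C) N)
      (fun B hB x hx => ?_) B
    exact ⟨_, hI.tensor_right _ _ hC (hI.tensor_left _ _ hB (thickIdealOf_self _ N)), hx⟩
  rintro x ⟨A, hA, hx⟩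
  exact hP.of_iso (whiskerRightIso (λ_ A) (𝟙_ K) ≪≫ ρ_ A) (thickIdealOf_le hQ hNQ A hA _ _) hx

end IsExtendedWeakSupport

/-- A compact object supported in `Φ_σ(⟨M⟩)` belongs to `⟨M⟩`. -/
theorem compactIdeal_of_supportedIn (hK : IsCompactlyGeneratedMonoidal K)
    (hσ : IsExtendedWeakSupport σ) (hfaith : IsFaithful σ) {M : K} (hM : IsCompactObj M) {N : K}
    (hN : IsCompactObj N) (hNM : Phi σ (compactIdeal N) ⊆ Phi σ (compactIdeal M)) :
    compactIdeal M N := by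
  have := hK.octahedral
  have := hK.hasCoproducts
  have hc := hK.isThickIdealOf_isCompactObj
  let I := compactIdeal M
  have hI : IsThickIdealOf IsCompactObj I := isThickIdealOf_thickIdealOf hc hM
  have hIM : I M := thickIdealOf_self _ M
  have := hK.compact_essentiallySmall
  have : ObjectProperty.EssentiallySmall.{v} I := ObjectProperty.EssentiallySmall.of_le hI.le
  have := hI.isTriangulated
  have hperp := hK.isThickIdealOf_rightOrthogonal hI
  -- The localization triangle of the unit, tensored with `N`.
  obtain ⟨E, L, a, b, d, hT, hL, hE, -⟩ := exists_bousfield_triangle I hI.le hI.shift (𝟙_ K)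
  have hNL : I.rightOrthogonal (N ⊗ L) := hperp.tensor_left L N trivial fun C f hC => hL C hC f
  -- `N ⊗ L` vanishes: its support is contained in that of `⟪M⟫`, which annihilates `⟪N ⊗ L⟫`.
  have hbig (A : K) : IsThickIdealOf ⊤ (bigIdeal A) :=
    isThickIdealOf_thickIdealOf isThickIdealOf_top_top trivial
  have hzero : IsZero (N ⊗ L) := by
    rw [← hfaith, Set.eq_empty_iff_forall_notMem]
    intro x hx
    have hxN : x ∈ Phi σ (bigIdeal N) := Phi_mono
      (thickIdealOf_le (hbig N) ((hbig N).tensor_right N L trivial (thickIdealOf_self _ N))) hx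
    have hxM : x ∈ Phi σ (bigIdeal M) := Phi_mono
      ((thickIdealOf_le (hc.inf (hbig M) hM (thickIdealOf_self _ M))
        ⟨hM, thickIdealOf_self _ M⟩).trans inf_le_right)
      (hNM (hσ.Phi_bigIdeal_subset hK hN hxN))
    have hxt : x ∈ Phi σ (tensorClass (bigIdeal M) (bigIdeal (N ⊗ L))) := by
      rw [hσ.tensor _ _ (hbig M) (hbig _)]
      exact ⟨hxM, hx⟩
    obtain ⟨C, ⟨A, B, hA, hB, ⟨e⟩⟩, hxC⟩ := hxt
    have hAB : IsZero (A ⊗ B) :=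
      thickIdealOf_le (hK.isThickIdealOf_annihilator (hbig (N ⊗ L)))
        (fun B hB => hK.isZero_tensor_rightOrthogonal hI hIM (thickIdealOf_le hperp hNL B hB))
        A hA B hB
    rw [hσ.zero C (hAB.of_iso e)] at hxC
    exact hxC
  -- Hence `N ≅ N ⊗ E` lies in the localizing class generated by `I`.
  have hNE (P : ObjectProperty K) (hP : IsLocalizingClass P) (hIP : I ≤ P) : P N := by
    have h : P (N ⊗ E) := hE _ (hK.isLocalizingClass_tensorLeft hP N)
      fun C hC => hIP _ (hI.tensor_left _ _ hN hC)
    obtain ⟨_, _⟩ := hK.exact_tensorLeft N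
    have hiso : IsIso ((tensorLeft N).map a) :=
      (Triangle.isZero₃_iff_isIso₁ _ ((tensorLeft N).map_distinguished _ hT)).1 hzero
    exact hP.of_iso (asIso ((tensorLeft N).map a) ≪≫ ρ_ N) h
  -- In the localization triangle of `N` itself, the morphism `N ⟶ L'` vanishes.
  obtain ⟨E', L', a', b', d', hT', hL', -, hfac⟩ :=
    exists_bousfield_triangle I hI.le hI.shift N
  have hb' : b' = 0 := hNE _ (isLocalizingClass_leftOrthogonal I.rightOrthogonal)
    (fun C hC B f hB => hB f hC) b' fun C f hC => hL' C hC f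
  obtain ⟨s, hs⟩ : ∃ s : N ⟶ E', 𝟙 N = s ≫ a' :=
    Triangle.coyoneda_exact₂ _ hT' (𝟙 N) ((Category.id_comp b').trans hb')
  obtain ⟨Z, hZ, g, i, hgi⟩ := hfac N hN s
  exact hI.of_retract_isCellular hZ hN
    { i := g, r := i ≫ a', retract := by rw [← Category.assoc, ← hgi, ← hs] }

end Support

end NCHopkins

theorem theoremT {K : Type u} [Category.{v} K] [Preadditive K] [HasZeroObject K] [HasShift K ℤ]
    [∀ n : ℤ, (shiftFunctor K n).Additive] [Pretriangulated K] [MonoidalCategory K]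
    (hK : NCHopkins.IsCompactlyGeneratedMonoidal K)
    {X : Type w} [TopologicalSpace X] (hX : NCHopkins.IsZariskiSpace X)
    (σ : K → Set X) (hσ : NCHopkins.IsExtendedWeakSupport σ) (hfaith : NCHopkins.IsFaithful σ)
    (M : K) (hM : NCHopkins.IsCompactObj M) :
    NCHopkins.supportedIn σ (NCHopkins.Phi σ (NCHopkins.compactIdeal M)) =
      NCHopkins.compactIdeal M := by
  ext N
  refine ⟨fun h => NCHopkins.compactIdeal_of_supportedIn hK hσ hfaith hM h.1 h.2, fun h => ?_⟩
  have hc := hK.isThickIdealOf_isCompactObj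
  exact ⟨NCHopkins.thickIdealOf_le hc hM N h,
    NCHopkins.Phi_mono (NCHopkins.thickIdealOf_le
      (NCHopkins.isThickIdealOf_thickIdealOf hc hM) h)⟩
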